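/- Let $\mathcal G$ be a connected undirected graph on $N\ge 2$ vertices $\mathcal N=\{1,\dots,N\}$ with real edge weights, whose combinatorial Laplacian $L$ is positive semidefinite with $N$ distinct eigenvalues $0=\lambda_1<\lambda_2<\dots<\lambda_N$, and let $L=U\,\mathrm{diag}(\lambda_1,\dots,\lambda_N)\,U^{T}$ with $U$ orthogonal. Let $1\le k\le N$, let $U_{k}$ be the matrix of the first $k$ columns of $U$, and let $x$ be a random vector with values in the span of these columns, $\mathbb E x=0$ and $\mathrm{Cov}(x)=U_kU_k^{T}$. Let $\epsilon$ be a random vector in $\mathbb R^N$, independent of $x$, with $\mathbb E\epsilon=0$ and $\mathrm{Cov}(\epsilon)=I_N$ (full-band noise), let $\sigma>0$, $n=\sigma\epsilon$, and $\mathrm{SNR}=\mathbb E\|x\|_2^2/\mathbb E\|n\|_2^2$. For $\mu>0$ and a non-empty sample set $S\subseteq\mathcal N$, the graph-Laplacian-regularised (GLR) reconstruction of $x$ from the observation $(x+n)_S$ is $$\hat x=\operatorname*{arg\,min}_{z\in\mathbb R^N}\ \|z_S-(x+n)_S\|_2^2+\mu z^{T}Lz ,\qquad \mathrm{MSE}_S=\mathbb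 E\|\hat x-x\|_2^2,$$ and $S$ is called better than $\mathcal N$ if $\mathrm{MSE}_S<\mathrm{MSE}_{\mathcal N}$. Put $$\bar\lambda=\frac1N\sum_{i=1}^N\lambda_i,\qquad r=\frac14\left(\sqrt{\frac{\lambda_N}{\lambda_2}}+\sqrt{\frac{\lambda_2}{\lambda_N}}\right)^2 .$$ Suppose that $2r\sqrt N<N$, and let $$\mu_{ub\_weak}=\bar\lambda^{-1}\left(N^{1/4}(2r)^{-1/2}-1\right),\qquad \tau_{GLR\_weak}(\mu)=\frac{\sqrt N(1+\mu\bar\lambda)^{-2}-2r}{\sqrt N+2r\,N/k}.$$ Then for every $\mu\in(0,\mu_{ub\_weak})$, if $\mathrm{SNR}<\tau_{GLR\_weak}(\mu)$, then every sample set $S$ of size $\lceil\sqrt N\rceil$ is better than $\mathcal N$ under GLR with parameter $\mu$. -/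

import Mathlib

open MeasureTheory ProbabilityTheory Matrix

noncomputable section

/-- An undirected graph on the vertices `Fin N` with real edge weights and no self-loops;
a weight `0` means that there is no edge. -/
structure WeightedGraph (N : ℕ) where
  weight : Fin N → Fin N → ℝ
  symm : ∀ i j, weight i j = weight j i
  loopless : ∀ i, weight i i = 0

namespace WeightedGraph

variable {N : ℕ}

/-- The underlying simple graph: an edge joins `i` and `j` when its weight is not zero. -/
def toSimpleGraph (G : WeightedGraph N) : SimpleGraph (Fin N) where
  Adj i j := G.weight i j ≠ 0
  symm := ⟨fun i j h => by rw [G.symm j i]; exact h⟩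
  loopless := ⟨fun i h => h (G.loopless i)⟩

/-- The combinatorial Laplacian: the diagonal matrix of weighted degrees minus the weight matrix. -/
def laplacian (G : WeightedGraph N) : Matrix (Fin N) (Fin N) ℝ :=
  Matrix.diagonal (fun i => ∑ j, G.weight i j) - Matrix.of G.weight

/-- `L = U diag(lam) Uᵀ` with `U` orthogonal (its columns are an orthonormal eigenbasis) and
`N` distinct eigenvalues `0 = lam₁ < lam₂ < ⋯ < lam_N`; entry `i` of `lam` is the eigenvalue
number `i + 1`.  In particular, `L` is positive semidefinite. -/
structure IsEigendecomposition (G : WeightedGraph N) (U : Matrix (Fin N) (Fin N) ℝ)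
    (lam : Fin N → ℝ) : Prop where
  orthogonal : Uᵀ * U = 1
  eq_laplacian : G.laplacian = U * Matrix.diagonal lam * Uᵀ
  first_eq_zero : ∀ i : Fin N, (i : ℕ) = 0 → lam i = 0
  strictMono : StrictMono lam

end WeightedGraph

/-- The squared Euclidean norm of a real vector. -/
def sqNorm {ι : Type*} [Fintype ι] (v : ι → ℝ) : ℝ := ∑ i, v i ^ 2

/-- The objective of graph-Laplacian-regularised (GLR) reconstruction from the values `y` observed
on the sample set `S`: `‖z_S - y‖² + μ zᵀ L z`. -/
def glrObjective {N : ℕ} (G : WeightedGraph N) (μ : ℝ) (S : Finset (Fin N)) (y : S → ℝ)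
    (z : Fin N → ℝ) : ℝ :=
  sqNorm (fun i : S => z i - y i) + μ * (z ⬝ᵥ (G.laplacian *ᵥ z))

/-- The GLR reconstruction: the minimiser over all of `ℝᴺ` of the GLR objective.  (It exists and is
unique as soon as `S` is non-empty, `μ > 0` and `0` is a simple, smallest eigenvalue of `L`.) -/
def glrReconstruction {N : ℕ} (G : WeightedGraph N) (μ : ℝ) (S : Finset (Fin N)) (y : S → ℝ) :
    Fin N → ℝ :=
  Classical.epsilon fun z => IsMinOn (glrObjective G μ S y) Set.univ z

/-- The first `k` columns of `U`. -/
def firstColumns {N k : ℕ} (hk : k ≤ N) (U : Matrix (Fin N) (Fin N) ℝ) :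
    Matrix (Fin N) (Fin k) ℝ :=
  U.submatrix id (Fin.castLE hk)

/-- The projection onto the span of the first `k` columns of `U`. -/
def bandlimitProj {N k : ℕ} (hk : k ≤ N) (U : Matrix (Fin N) (Fin N) ℝ) :
    Matrix (Fin N) (Fin N) ℝ :=
  firstColumns hk U * (firstColumns hk U)ᵀ

/-- `g` is a square-integrable random vector with mean zero and covariance matrix `C`. -/
structure HasMeanZeroCov {Ω : Type*} [MeasurableSpace Ω] {N : ℕ} (P : Measure Ω)
    (g : Ω → Fin N → ℝ) (C : Matrix (Fin N) (Fin N) ℝ) : Prop where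
  memLp : ∀ i, MemLp (fun ω => g ω i) 2 P
  mean_zero : ∀ i, ∫ ω, g ω i ∂P = 0
  covariance_eq : ∀ i j, covariance (fun ω => g ω i) (fun ω => g ω j) P = C i j

/-- The random `k`-bandlimited signal: (almost surely) a linear combination of the first `k`
columns of `U`, with mean zero and covariance the projection onto their span. -/
structure IsBandlimitedSignal {Ω : Type*} [MeasurableSpace Ω] {N k : ℕ} (P : Measure Ω)
    (hk : k ≤ N) (U : Matrix (Fin N) (Fin N) ℝ) (x : Ω → Fin N → ℝ) : Prop where
  bandlimited : ∀ᵐ ω ∂P, ∃ c : Fin k → ℝ, x ω = firstColumns hk U *ᵥ c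
  moments : HasMeanZeroCov P x (bandlimitProj hk U)

/-- The signal-to-noise ratio `E‖x‖² / E‖n‖²`. -/
def snr {Ω : Type*} [MeasurableSpace Ω] {N : ℕ} (P : Measure Ω) (x n : Ω → Fin N → ℝ) : ℝ :=
  (∫ ω, sqNorm (x ω) ∂P) / ∫ ω, sqNorm (n ω) ∂P

/-- The mean squared error `E‖x̂ - x‖²` of GLR with parameter `μ` when the corrupted signal `x + n`
is observed on `S`; an expectation with values in `[0, ∞]`. -/
def glrMSE {Ω : Type*} [MeasurableSpace Ω] {N : ℕ} (P : Measure Ω) (G : WeightedGraph N) (μ : ℝ)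
    (x n : Ω → Fin N → ℝ) (S : Finset (Fin N)) : ENNReal :=
  ∫⁻ ω, ENNReal.ofReal
    (sqNorm (glrReconstruction G μ S (fun i : S => x ω i + n ω i) - x ω)) ∂P

/-- The sample set `T` is better than the sample set `S` under GLR: its mean squared error is
strictly smaller. -/
def GLRBetterThan {Ω : Type*} [MeasurableSpace Ω] {N : ℕ} (P : Measure Ω) (G : WeightedGraph N)
    (μ : ℝ) (x n : Ω → Fin N → ℝ) (T S : Finset (Fin N)) : Prop :=
  glrMSE P G μ x n T < glrMSE P G μ x n S

/-- `ω(t) = (√t + 1/√t)² / 4`. -/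
def kantorovichOmega (t : ℝ) : ℝ := (1 / 4) * (Real.sqrt t + 1 / Real.sqrt t) ^ 2

/-- `r = ω(lam_N / lam₂)`. -/
def spreadR {N : ℕ} (hN : 2 ≤ N) (lam : Fin N → ℝ) : ℝ :=
  kantorovichOmega (lam ⟨N - 1, by omega⟩ / lam ⟨1, by omega⟩)

/-- The mean eigenvalue. -/
def meanEigenvalue {N : ℕ} (lam : Fin N → ℝ) : ℝ := (1 / (N : ℝ)) * ∑ i, lam i

/-- `μ_ub_weak = lamBar⁻¹ (N^{1/4} (2r)^{-1/2} - 1)`. -/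
def muUbWeak {N : ℕ} (hN : 2 ≤ N) (lam : Fin N → ℝ) : ℝ :=
  (meanEigenvalue lam)⁻¹ *
    ((N : ℝ) ^ (1 / 4 : ℝ) * (2 * spreadR hN lam) ^ (-(1 / 2) : ℝ) - 1)

/-- `τ_GLR_weak(μ) = (√N (1 + μ lamBar)⁻² - 2r) / (√N + 2r N / k)`. -/
def tauGLRWeak {N : ℕ} (hN : 2 ≤ N) (k : ℕ) (lam : Fin N → ℝ) (μ : ℝ) : ℝ :=
  (Real.sqrt N / (1 + μ * meanEigenvalue lam) ^ 2 - 2 * spreadR hN lam) /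
    (Real.sqrt N + 2 * spreadR hN lam * ((N : ℝ) / (k : ℝ)))

end

/-! GLR is linear: the normal equations (P_S + μL)x̂ = P_S(x + n) give x̂ = H_S(x + n), and
independence splits MSE_S into a bias tr((H_S - 1)U_kU_kᵀ(H_S - 1)ᵀ) and a variance σ²‖H_S‖_F²
(`glrMSE_eq`). For the full vertex set the bias is dropped, and Jensen bounds the variance factor
below by N(1 + μλ̄)⁻² (`le_trace_glrOperator_univ`). For S, the bias is at most k + ‖H_S‖_F²,
because H_S never turns an eigenvector of L by more than a right angle (`trace_bias_le`). With
‖H_S‖_F² ≤ 2r√N, a bound free of μ, the condition SNR < τ becomes exactly the comparison of these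
estimates.

The heart is that Frobenius bound (`trace_glrOperator_le`). H_S fixes constants. If y has sum zero
on S, then z = H_S y has sum zero on S, is no larger than y on S, and satisfies Lz = 0 off S. So Lz
is orthogonal to the part of z off S, and Wielandt's inequality, for the spectrum [λ₂, λ_N] on the
complement of the constants, bounds that part, up to the mean of z, by (r - 1)‖z_S‖²
(`harmonic_extension_le`). Only the spectrum enters, so weights of either sign are covered.
Splitting each column of H_S into a constant and the image of a centred vector, then summing, gives
the bound. -/

theorem sqNorm_eq_dotProduct {ι : Type*} [Fintype ι] (v : ι → ℝ) : sqNorm v = v ⬝ᵥ v := by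
  simp [sqNorm, dotProduct, sq]

theorem dotProduct_self_nonneg_real {ι : Type*} [Fintype ι] (v : ι → ℝ) : 0 ≤ v ⬝ᵥ v := by
  rw [← sqNorm_eq_dotProduct]
  exact Finset.sum_nonneg fun _ _ => sq_nonneg _

theorem sq_dotProduct_le {ι : Type*} [Fintype ι] (v w : ι → ℝ) :
    (v ⬝ᵥ w) ^ 2 ≤ (v ⬝ᵥ v) * (w ⬝ᵥ w) := by
  simpa [dotProduct, sq] using Finset.sum_mul_sq_le_sq_mul_sq Finset.univ v w

/-- Test with w = g: a bound on a linear functional bounds the vector that represents it. -/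
theorem dotProduct_self_le_of_sq_dotProduct_le {ι : Type*} [Fintype ι] {g : ι → ℝ} {C : ℝ}
    (hC : 0 ≤ C) (h : ∀ w, (g ⬝ᵥ w) ^ 2 ≤ C * (w ⬝ᵥ w)) : g ⬝ᵥ g ≤ C := by
  have h1 := h g
  by_contra! h2
  nlinarith

/-- The sum of the squares of the entries of a matrix is the trace of its Gram matrix. -/
theorem trace_mul_transpose_self_eq {m n : Type*} [Fintype m] [Fintype n] (A : Matrix m n ℝ) :
    (A * Aᵀ).trace = ∑ j, A.col j ⬝ᵥ A.col j := by
  rw [trace_mul_comm]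
  simp [trace, Matrix.mul_apply, dotProduct]

/-! ### Spectral theory of the Laplacian and Wielandt's inequality -/

namespace WeightedGraph

variable {N : ℕ} (G : WeightedGraph N)

theorem laplacian_transpose : G.laplacianᵀ = G.laplacian := by
  ext i j
  by_cases h : i = j
  · subst h; simp [laplacian]
  · simp [laplacian, diagonal_apply_ne _ h, diagonal_apply_ne _ (Ne.symm h), G.symm i j]

theorem laplacian_mulVec_one : G.laplacian *ᵥ 1 = 0 := by
  ext i
  simp [laplacian, mulVec, dotProduct, diagonal_apply]

theorem dotProduct_laplacian_comm (y z : Fin N → ℝ) :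
    y ⬝ᵥ (G.laplacian *ᵥ z) = (G.laplacian *ᵥ y) ⬝ᵥ z := by
  rw [dotProduct_mulVec, ← mulVec_transpose, laplacian_transpose]

theorem one_dotProduct_laplacian (z : Fin N → ℝ) : 1 ⬝ᵥ (G.laplacian *ᵥ z) = 0 := by
  rw [dotProduct_laplacian_comm, laplacian_mulVec_one, zero_dotProduct]

namespace IsEigendecomposition

variable {G} {U : Matrix (Fin N) (Fin N) ℝ} {lam : Fin N → ℝ} (hU : G.IsEigendecomposition U lam)
include hU

theorem mul_transpose_eq_one : U * Uᵀ = 1 := mul_eq_one_comm.mp hU.orthogonal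

theorem dotProduct_transpose_mulVec (y z : Fin N → ℝ) :
    (Uᵀ *ᵥ y) ⬝ᵥ (Uᵀ *ᵥ z) = y ⬝ᵥ z := by
  rw [dotProduct_mulVec, ← mulVec_transpose, mulVec_mulVec, transpose_transpose,
    hU.mul_transpose_eq_one, one_mulVec]

theorem transpose_mulVec_laplacian (z : Fin N → ℝ) :
    Uᵀ *ᵥ (G.laplacian *ᵥ z) = fun i => lam i * (Uᵀ *ᵥ z) i := by
  rw [hU.eq_laplacian, mulVec_mulVec, ← mul_assoc, ← mul_assoc, hU.orthogonal, one_mul,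
    ← mulVec_mulVec]
  ext i
  rw [mulVec_diagonal]

theorem dotProduct_laplacian (z : Fin N → ℝ) :
    z ⬝ᵥ (G.laplacian *ᵥ z) = ∑ i, lam i * (Uᵀ *ᵥ z) i ^ 2 := by
  rw [← hU.dotProduct_transpose_mulVec, hU.transpose_mulVec_laplacian]
  simp only [dotProduct]
  exact Finset.sum_congr rfl fun i _ => by ring

theorem laplacian_mulVec_col (j : Fin N) : G.laplacian *ᵥ U.col j = lam j • U.col j := by
  have h : U.col j = U *ᵥ Pi.single j 1 := by simp
  rw [h, hU.eq_laplacian, mulVec_mulVec, mul_assoc, hU.orthogonal, mul_one, ← mulVec_mulVec,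
    ← mulVec_smul]
  congr 1
  ext i
  rw [mulVec_diagonal]
  by_cases hij : i = j
  · subst hij; simp
  · simp [hij]

theorem col_dotProduct_self (j : Fin N) : U.col j ⬝ᵥ U.col j = 1 := by
  have h := congrFun (congrFun hU.orthogonal j) j
  simpa [Matrix.mul_apply, dotProduct] using h

theorem lam_nonneg (i : Fin N) : 0 ≤ lam i := by
  rw [← hU.first_eq_zero ⟨0, i.pos⟩ rfl]
  exact hU.strictMono.monotone (Fin.mk_le_of_le_val (Nat.zero_le _))

theorem lam_pos {i : Fin N} (hi : (i : ℕ) ≠ 0) : 0 < lam i := by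
  rw [← hU.first_eq_zero ⟨0, i.pos⟩ rfl]
  exact hU.strictMono (Fin.mk_lt_of_lt_val (Nat.pos_of_ne_zero hi))

theorem laplacian_nonneg (z : Fin N → ℝ) : 0 ≤ z ⬝ᵥ (G.laplacian *ᵥ z) := by
  rw [hU.dotProduct_laplacian]
  exact Finset.sum_nonneg fun i _ => mul_nonneg (hU.lam_nonneg i) (sq_nonneg _)

theorem transpose_mulVec_one {i : Fin N} (hi : (i : ℕ) ≠ 0) : (Uᵀ *ᵥ 1) i = 0 := by
  have h := congrFun (hU.transpose_mulVec_laplacian 1) i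
  rw [laplacian_mulVec_one, mulVec_zero] at h
  exact (mul_eq_zero.mp h.symm).resolve_left (hU.lam_pos hi).ne'

/-- A vector with vanishing Laplacian energy is constant. -/
theorem eq_const_of_laplacian_eq_zero {z : Fin N → ℝ} (hz : z ⬝ᵥ (G.laplacian *ᵥ z) = 0)
    (i j : Fin N) : z i = z j := by
  have h0 : ∀ l : Fin N, (l : ℕ) ≠ 0 → (Uᵀ *ᵥ z) l = 0 := by
    intro l hl
    rw [hU.dotProduct_laplacian, Finset.sum_eq_zero_iff_of_nonneg
      (fun i _ => mul_nonneg (hU.lam_nonneg i) (sq_nonneg _))] at hz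
    have := hz l (Finset.mem_univ _)
    simpa [(hU.lam_pos hl).ne'] using this
  -- The eigenvalue 0 is simple, so both z and the constant vector are multiples of the first
  -- eigenvector; the latter shows that this eigenvector is itself constant.
  have hexp : ∀ y : Fin N → ℝ, (∀ l : Fin N, (l : ℕ) ≠ 0 → (Uᵀ *ᵥ y) l = 0) →
      ∀ l, y l = U l ⟨0, i.pos⟩ * (Uᵀ *ᵥ y) ⟨0, i.pos⟩ := by
    intro y hy l
    have h1 : U *ᵥ (Uᵀ *ᵥ y) = y := by
      rw [mulVec_mulVec, hU.mul_transpose_eq_one, one_mulVec]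
    conv_lhs => rw [← h1]
    rw [mulVec, dotProduct, Finset.sum_eq_single ⟨0, i.pos⟩]
    · intro b _ hb
      rw [hy b (fun h => hb (Fin.ext h)), mul_zero]
    · simp
  have h1 := hexp 1 (fun l hl => hU.transpose_mulVec_one hl)
  have hz' := hexp z h0
  have hi := h1 i
  have hj := h1 j
  simp only [Pi.one_apply] at hi hj
  rw [hz' i, hz' j]
  have hc : (Uᵀ *ᵥ (1 : Fin N → ℝ)) ⟨0, i.pos⟩ ≠ 0 := by
    intro h; rw [h] at hi; simp at hi
  rw [mul_right_cancel₀ hc (hi.symm.trans hj)]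

/-- The constant vector has only its first spectral coordinate nonzero, so orthogonality to it kills
the first coordinate of y. -/
theorem transpose_mulVec_zero {y : Fin N → ℝ} (hy : 1 ⬝ᵥ y = 0) {i : Fin N} (hi : (i : ℕ) = 0) :
    (Uᵀ *ᵥ y) i = 0 := by
  rw [← hU.dotProduct_transpose_mulVec, dotProduct, Finset.sum_eq_single i] at hy
  · refine (mul_eq_zero.mp hy).resolve_left fun h => ?_
    have h1 := hU.dotProduct_transpose_mulVec 1 1
    have h2 : Uᵀ *ᵥ (1 : Fin N → ℝ) = 0 := by
      ext l
      by_cases hl : (l : ℕ) = 0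
      · rw [show l = i from Fin.ext (hl.trans hi.symm), h]; rfl
      · exact hU.transpose_mulVec_one hl
    rw [h2, zero_dotProduct, one_dotProduct_one, Fintype.card_fin] at h1
    exact i.pos.ne (Nat.cast_eq_zero.mp h1.symm).symm
  · intro b _ hb
    rw [hU.transpose_mulVec_one (fun h => hb (Fin.ext (h.trans hi.symm))), zero_mul]
  · simp

/-- On the orthogonal complement of the constants the spectrum of the Laplacian lies between the
second and the last eigenvalue. -/
theorem laplacian_sub_smul_sq_le (hN : 2 ≤ N) {y : Fin N → ℝ} (hy : 1 ⬝ᵥ y = 0) {b d : ℝ}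
    (hb : b - d = lam ⟨1, by omega⟩) (hd : b + d = lam ⟨N - 1, by omega⟩) :
    (G.laplacian *ᵥ y - b • y) ⬝ᵥ (G.laplacian *ᵥ y - b • y) ≤ d ^ 2 * (y ⬝ᵥ y) := by
  rw [← hU.dotProduct_transpose_mulVec, ← hU.dotProduct_transpose_mulVec y, mulVec_sub,
    hU.transpose_mulVec_laplacian, mulVec_smul]
  simp only [dotProduct, Finset.mul_sum, Pi.sub_apply, Pi.smul_apply, smul_eq_mul]
  refine Finset.sum_le_sum fun i _ => ?_
  by_cases hi : (i : ℕ) = 0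
  · simp [hU.transpose_mulVec_zero hy hi]
  · have h1 : lam ⟨1, by omega⟩ ≤ lam i :=
      hU.strictMono.monotone (Fin.mk_le_of_le_val (Nat.one_le_iff_ne_zero.mpr hi))
    have h2 : lam i ≤ lam ⟨N - 1, by omega⟩ :=
      hU.strictMono.monotone (Fin.le_def.mpr (by have := i.isLt; simp; omega))
    have h3 : (lam i - b) ^ 2 ≤ d ^ 2 := sq_le_sq' (by linarith) (by linarith)
    nlinarith [mul_le_mul_of_nonneg_right h3 (sq_nonneg ((Uᵀ *ᵥ y) i))]

/-- **Wielandt's inequality** for the Laplacian: vectors orthogonal to the constants and conjugate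
with respect to the Laplacian make an angle that is bounded away from zero. -/
theorem wielandt (hN : 2 ≤ N) {y v : Fin N → ℝ} (hy : 1 ⬝ᵥ y = 0)
    (hyv : (G.laplacian *ᵥ y) ⬝ᵥ v = 0) {b d : ℝ}
    (hb : b - d = lam ⟨1, by omega⟩) (hd : b + d = lam ⟨N - 1, by omega⟩) :
    b ^ 2 * (y ⬝ᵥ v) ^ 2 ≤ d ^ 2 * (y ⬝ᵥ y) * (v ⬝ᵥ v) := by
  -- Since Ly is orthogonal to v, pairing Ly - by with v leaves only -b(y·v). Here b is the midpoint
  -- of [λ₂, λ_N] and d its half-length, so ‖Ly - by‖ ≤ d‖y‖.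
  have h1 := sq_dotProduct_le (G.laplacian *ᵥ y - b • y) v
  have h2 := hU.laplacian_sub_smul_sq_le hN hy hb hd
  have h3 : 0 ≤ v ⬝ᵥ v := dotProduct_self_nonneg_real v
  rw [sub_dotProduct, hyv, smul_dotProduct, smul_eq_mul] at h1
  nlinarith [mul_le_mul_of_nonneg_right h2 h3]

end IsEigendecomposition

end WeightedGraph

/-! ### The GLR operator and its normal equations -/

/-- The coordinate projection onto a sample set. -/
def sampleProj {N : ℕ} (S : Finset (Fin N)) : Matrix (Fin N) (Fin N) ℝ :=
  diagonal fun i => if i ∈ S then 1 else 0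

theorem sampleProj_mulVec {N : ℕ} (S : Finset (Fin N)) (y : Fin N → ℝ) (i : Fin N) :
    (sampleProj S *ᵥ y) i = if i ∈ S then y i else 0 := by
  simp [sampleProj, mulVec_diagonal]

theorem dotProduct_sampleProj_mulVec {N : ℕ} (S : Finset (Fin N)) (y z : Fin N → ℝ) :
    z ⬝ᵥ (sampleProj S *ᵥ y) = ∑ i ∈ S, z i * y i := by
  simp [dotProduct, sampleProj_mulVec, Finset.sum_ite_mem]

namespace WeightedGraph

variable {N : ℕ} (G : WeightedGraph N)

/-- The Hessian (up to a factor two) of the GLR objective. -/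
noncomputable def glrMatrix (μ : ℝ) (S : Finset (Fin N)) : Matrix (Fin N) (Fin N) ℝ :=
  sampleProj S + μ • G.laplacian

/-- The linear map that sends a corrupted signal to its GLR reconstruction. -/
noncomputable def glrOperator (μ : ℝ) (S : Finset (Fin N)) : Matrix (Fin N) (Fin N) ℝ :=
  (G.glrMatrix μ S)⁻¹ * sampleProj S

theorem dotProduct_glrMatrix (μ : ℝ) (S : Finset (Fin N)) (y z : Fin N → ℝ) :
    y ⬝ᵥ (G.glrMatrix μ S *ᵥ z) = ∑ i ∈ S, y i * z i + μ * (y ⬝ᵥ (G.laplacian *ᵥ z)) := by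
  rw [glrMatrix, add_mulVec, dotProduct_add, dotProduct_sampleProj_mulVec, smul_mulVec,
    dotProduct_smul, smul_eq_mul]

namespace IsEigendecomposition

variable {G} {U : Matrix (Fin N) (Fin N) ℝ} {lam : Fin N → ℝ} (hU : G.IsEigendecomposition U lam)
  {μ : ℝ} (hμ : 0 < μ) {S : Finset (Fin N)}
include hU hμ

theorem glrMatrix_nonneg (z : Fin N → ℝ) : 0 ≤ z ⬝ᵥ (G.glrMatrix μ S *ᵥ z) := by
  rw [dotProduct_glrMatrix]
  exact add_nonneg (Finset.sum_nonneg fun i _ => mul_self_nonneg _)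
    (mul_nonneg hμ.le (hU.laplacian_nonneg z))

variable (hS : S.Nonempty)
include hS

/-- Zero energy forces z to be constant, and a single sample then forces the constant to be 0. -/
theorem eq_zero_of_glrMatrix_eq_zero {z : Fin N → ℝ} (hz : z ⬝ᵥ (G.glrMatrix μ S *ᵥ z) = 0) :
    z = 0 := by
  rw [dotProduct_glrMatrix] at hz
  have h1 : 0 ≤ ∑ i ∈ S, z i * z i := Finset.sum_nonneg fun i _ => mul_self_nonneg _
  have h2 := mul_nonneg hμ.le (hU.laplacian_nonneg z)
  have h3 : z ⬝ᵥ (G.laplacian *ᵥ z) = 0 :=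
    (mul_eq_zero.mp (by linarith)).resolve_left hμ.ne'
  obtain ⟨i, hi⟩ := hS
  have h4 : ∑ i ∈ S, z i * z i = 0 := by linarith
  rw [Finset.sum_eq_zero_iff_of_nonneg (fun i _ => mul_self_nonneg _)] at h4
  ext j
  rw [hU.eq_const_of_laplacian_eq_zero h3 j i]
  exact mul_self_eq_zero.mp (h4 i hi)

theorem isUnit_det_glrMatrix : IsUnit (G.glrMatrix μ S).det := by
  rw [isUnit_iff_ne_zero]
  intro h
  obtain ⟨v, hv, hv0⟩ := exists_mulVec_eq_zero_iff.mpr h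
  exact hv (hU.eq_zero_of_glrMatrix_eq_zero hμ hS (by rw [hv0, dotProduct_zero]))

theorem glrMatrix_mul_glrOperator : G.glrMatrix μ S * G.glrOperator μ S = sampleProj S := by
  rw [glrOperator, mul_nonsing_inv_cancel_left _ _ (hU.isUnit_det_glrMatrix hμ hS)]

theorem glrMatrix_mulVec_glrOperator (y : Fin N → ℝ) :
    G.glrMatrix μ S *ᵥ (G.glrOperator μ S *ᵥ y) = sampleProj S *ᵥ y := by
  rw [mulVec_mulVec, hU.glrMatrix_mul_glrOperator hμ hS]

theorem glrOperator_mulVec_one : G.glrOperator μ S *ᵥ 1 = 1 := by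
  have h : sampleProj S *ᵥ (1 : Fin N → ℝ) = G.glrMatrix μ S *ᵥ 1 := by
    rw [glrMatrix, add_mulVec, smul_mulVec, laplacian_mulVec_one, smul_zero, add_zero]
  rw [glrOperator, ← mulVec_mulVec, h, mulVec_mulVec,
    nonsing_inv_mul _ (hU.isUnit_det_glrMatrix hμ hS), one_mulVec]

theorem dotProduct_glrOperator (y z : Fin N → ℝ) :
    ∑ i ∈ S, z i * (G.glrOperator μ S *ᵥ y) i
      + μ * (z ⬝ᵥ (G.laplacian *ᵥ (G.glrOperator μ S *ᵥ y))) = ∑ i ∈ S, z i * y i := by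
  rw [← dotProduct_glrMatrix, hU.glrMatrix_mulVec_glrOperator hμ hS, dotProduct_sampleProj_mulVec]

/-- Off S the normal equations contain no data term, so the reconstruction is harmonic there. -/
theorem laplacian_glrOperator_eq_zero (y : Fin N → ℝ) {i : Fin N} (hi : i ∉ S) :
    (G.laplacian *ᵥ (G.glrOperator μ S *ᵥ y)) i = 0 := by
  have h := congrFun (hU.glrMatrix_mulVec_glrOperator hμ hS y) i
  rw [glrMatrix, add_mulVec, Pi.add_apply, sampleProj_mulVec, sampleProj_mulVec, if_neg hi,
    if_neg hi, zero_add, smul_mulVec, Pi.smul_apply, smul_eq_mul] at h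
  exact (mul_eq_zero.mp h).resolve_left hμ.ne'

theorem sum_glrOperator (y : Fin N → ℝ) :
    ∑ i ∈ S, (G.glrOperator μ S *ᵥ y) i = ∑ i ∈ S, y i := by
  have h := hU.dotProduct_glrOperator hμ hS y 1
  rw [one_dotProduct_laplacian] at h
  simpa using h

/-- Testing the normal equations with the solution z itself gives ‖z_S‖² ≤ z_S·y_S, since the energy
of z is nonnegative. -/
theorem sum_sq_glrOperator_le (y : Fin N → ℝ) :
    ∑ i ∈ S, (G.glrOperator μ S *ᵥ y) i ^ 2 ≤ ∑ i ∈ S, y i ^ 2 := by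
  have h := hU.dotProduct_glrOperator hμ hS y (G.glrOperator μ S *ᵥ y)
  have h1 := mul_nonneg hμ.le (hU.laplacian_nonneg (G.glrOperator μ S *ᵥ y))
  have h2 : 0 ≤ ∑ i ∈ S, ((G.glrOperator μ S *ᵥ y) i - y i) ^ 2 :=
    Finset.sum_nonneg fun i _ => sq_nonneg _
  simp only [sub_sq, Finset.sum_add_distrib, Finset.sum_sub_distrib, mul_assoc,
    ← Finset.mul_sum] at h2
  simp only [← sq] at h
  linarith

/-- Completing the square: the cross term vanishes by the normal equations. Definiteness of the
remaining quadratic form makes the minimiser unique. -/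
theorem glrObjective_eq (y z : Fin N → ℝ) :
    glrObjective G μ S (fun i : S => y i) z =
      glrObjective G μ S (fun i : S => y i) (G.glrOperator μ S *ᵥ y) +
        (z - G.glrOperator μ S *ᵥ y) ⬝ᵥ (G.glrMatrix μ S *ᵥ (z - G.glrOperator μ S *ᵥ y)) := by
  have h := hU.dotProduct_glrOperator hμ hS y (z - G.glrOperator μ S *ᵥ y)
  rw [dotProduct_glrMatrix]
  set w := G.glrOperator μ S *ᵥ y
  have hcomm : w ⬝ᵥ (G.laplacian *ᵥ z) = z ⬝ᵥ (G.laplacian *ᵥ w) := by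
    rw [dotProduct_laplacian_comm, dotProduct_comm]
  simp only [sub_dotProduct, mulVec_sub, dotProduct_sub, hcomm] at h ⊢
  have e : ∀ f : Fin N → ℝ, sqNorm (fun i : S => f i - y i) = ∑ i ∈ S, (f i - y i) ^ 2 :=
    fun f => Finset.sum_coe_sort S fun i => (f i - y i) ^ 2
  simp only [glrObjective, e]
  have h2 : ∑ i ∈ S, (z i - y i) ^ 2 = ∑ i ∈ S, (w i - y i) ^ 2
      + ∑ i ∈ S, (z - w) i * (z - w) i
      + 2 * (∑ i ∈ S, (z - w) i * w i - ∑ i ∈ S, (z - w) i * y i) := by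
    rw [← Finset.sum_sub_distrib, Finset.mul_sum, ← Finset.sum_add_distrib,
      ← Finset.sum_add_distrib]
    exact Finset.sum_congr rfl fun i _ => by simp only [Pi.sub_apply]; ring
  rw [h2]
  linarith

theorem glrReconstruction_eq (y : Fin N → ℝ) :
    glrReconstruction G μ S (fun i : S => y i) = G.glrOperator μ S *ᵥ y := by
  have hmin : IsMinOn (glrObjective G μ S fun i : S => y i) Set.univ (G.glrOperator μ S *ᵥ y) := by
    intro z _
    rw [Set.mem_ofPred_eq, hU.glrObjective_eq hμ hS y z]
    exact le_add_of_nonneg_right (hU.glrMatrix_nonneg hμ _)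
  have hspec : IsMinOn (glrObjective G μ S fun i : S => y i) Set.univ
      (glrReconstruction G μ S fun i : S => y i) := Classical.epsilon_spec ⟨_, hmin⟩
  have h1 := hspec (Set.mem_univ (G.glrOperator μ S *ᵥ y))
  rw [Set.mem_ofPred_eq, hU.glrObjective_eq hμ hS y (glrReconstruction G μ S fun i : S => y i)] at h1
  exact sub_eq_zero.mp (hU.eq_zero_of_glrMatrix_eq_zero hμ hS
    (le_antisymm (by linarith) (hU.glrMatrix_nonneg hμ _)))

/-- The reconstruction of an eigenvector makes an acute angle with it. -/
theorem col_dotProduct_glrOperator_nonneg (j : Fin N) :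
    0 ≤ U.col j ⬝ᵥ (G.glrOperator μ S *ᵥ U.col j) := by
  set u := U.col j
  set A := G.glrMatrix μ S
  set w := A⁻¹ *ᵥ u
  have hdet := hU.isUnit_det_glrMatrix hμ hS
  -- With c = μλ_j, u·Hu = 1 - c(w·u), so c(w·u) ≤ 1 is needed. It follows from w·u = w·Aw ≥ μ w·Lw
  -- ≥ c(w·u)².
  have hAw : A *ᵥ w = u := by
    rw [mulVec_mulVec, mul_nonsing_inv _ hdet, one_mulVec]
  have hH : G.glrOperator μ S *ᵥ u = u - (μ * lam j) • w := by
    have h1 : sampleProj S *ᵥ u = A *ᵥ u - (μ * lam j) • u := by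
      rw [show A = sampleProj S + μ • G.laplacian from rfl, add_mulVec, smul_mulVec,
        hU.laplacian_mulVec_col, smul_smul, add_sub_cancel_right]
    rw [glrOperator, ← mulVec_mulVec, h1, mulVec_sub, mulVec_mulVec, nonsing_inv_mul _ hdet,
      one_mulVec, mulVec_smul]
  have h1 := dotProduct_glrMatrix G μ S w w
  rw [show G.glrMatrix μ S = A from rfl, hAw] at h1
  have h2 : 0 ≤ ∑ i ∈ S, w i * w i := Finset.sum_nonneg fun i _ => mul_self_nonneg _
  -- the energy of `w` dominates that of its component along `u`
  have h3 : lam j * (w ⬝ᵥ u) ^ 2 ≤ w ⬝ᵥ (G.laplacian *ᵥ w) := by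
    rw [hU.dotProduct_laplacian]
    have e : w ⬝ᵥ u = (Uᵀ *ᵥ w) j := dotProduct_comm _ _
    rw [e]
    exact Finset.single_le_sum (f := fun i => lam i * (Uᵀ *ᵥ w) i ^ 2)
      (fun i _ => mul_nonneg (hU.lam_nonneg i) (sq_nonneg _)) (Finset.mem_univ j)
  rw [hH, dotProduct_sub, hU.col_dotProduct_self, dotProduct_smul, smul_eq_mul, dotProduct_comm]
  have hc := mul_nonneg hμ.le (hU.lam_nonneg j)
  have h4 : (μ * lam j) * (w ⬝ᵥ u) ^ 2 ≤ w ⬝ᵥ u := by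
    nlinarith [mul_le_mul_of_nonneg_left h3 hμ.le]
  by_contra! h5
  nlinarith

theorem glrOperator_sub_one_col_le (j : Fin N) :
    ((G.glrOperator μ S - 1) *ᵥ U.col j) ⬝ᵥ ((G.glrOperator μ S - 1) *ᵥ U.col j) ≤
      (G.glrOperator μ S *ᵥ U.col j) ⬝ᵥ (G.glrOperator μ S *ᵥ U.col j) + 1 := by
  have h := hU.col_dotProduct_glrOperator_nonneg hμ hS j
  rw [sub_mulVec, one_mulVec, sub_dotProduct, dotProduct_sub, dotProduct_sub,
    hU.col_dotProduct_self, dotProduct_comm (G.glrOperator μ S *ᵥ U.col j) (U.col j)]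
  linarith

end IsEigendecomposition

end WeightedGraph

/-! ### Frobenius norm and bias of the GLR operator -/

namespace WeightedGraph

namespace IsEigendecomposition

variable {N : ℕ} {G : WeightedGraph N} {U : Matrix (Fin N) (Fin N) ℝ} {lam : Fin N → ℝ}
  (hU : G.IsEigendecomposition U lam)
include hU

theorem four_mul_spreadR (hN : 2 ≤ N) :
    4 * lam ⟨1, by omega⟩ * lam ⟨N - 1, by omega⟩ * spreadR hN lam =
      (lam ⟨1, by omega⟩ + lam ⟨N - 1, by omega⟩) ^ 2 := by
  have h1 : 0 < lam ⟨1, by omega⟩ := hU.lam_pos (by simp)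
  have h2 : 0 < lam ⟨N - 1, by omega⟩ := hU.lam_pos (by simp; omega)
  have ht := div_pos h2 h1
  have h3 : (Real.sqrt (lam ⟨N - 1, by omega⟩ / lam ⟨1, by omega⟩)) ^ 2 = _ := Real.sq_sqrt ht.le
  have h4 : spreadR hN lam = (1 / 4) * (lam ⟨N - 1, by omega⟩ / lam ⟨1, by omega⟩ + 2
      + 1 / (lam ⟨N - 1, by omega⟩ / lam ⟨1, by omega⟩)) := by
    rw [spreadR, kantorovichOmega, add_sq, mul_assoc 2, mul_one_div_cancel (Real.sqrt_pos.mpr ht).ne',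
      div_pow, h3, one_pow, mul_one]
  rw [h4]
  field_simp
  ring

theorem one_le_spreadR (hN : 2 ≤ N) : 1 ≤ spreadR hN lam := by
  have h1 : 0 < lam ⟨1, by omega⟩ := hU.lam_pos (by simp)
  have h2 : 0 < lam ⟨N - 1, by omega⟩ := hU.lam_pos (by simp; omega)
  have h := hU.four_mul_spreadR hN
  have h3 := mul_pos h1 h2
  nlinarith [sq_nonneg (lam ⟨1, by omega⟩ - lam ⟨N - 1, by omega⟩)]

/-- Size of a vector that is harmonic off `S` and has mean zero on `S`. -/
theorem harmonic_extension_le (hN : 2 ≤ N) {S : Finset (Fin N)} {z : Fin N → ℝ}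
    (hz : ∀ i ∉ S, (G.laplacian *ᵥ z) i = 0) (hz0 : ∑ i ∈ S, z i = 0) :
    z ⬝ᵥ z ≤ spreadR hN lam * ∑ i ∈ S, z i ^ 2 + (1 ⬝ᵥ z) ^ 2 / N ∧
    S.card * (1 ⬝ᵥ z) ^ 2 ≤ N * (N - S.card) * (spreadR hN lam - 1) * ∑ i ∈ S, z i ^ 2 := by
  have hr := hU.four_mul_spreadR hN
  have hr1 := hU.one_le_spreadR hN
  set r := spreadR hN lam
  set l := lam ⟨1, by omega⟩ with hl
  set u := lam ⟨N - 1, by omega⟩ with hu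
  have hl0 : 0 < l := hU.lam_pos (by simp)
  have hu0 : 0 < u := hU.lam_pos (by simp; omega)
  have hN0 : (0 : ℝ) < N := by exact_mod_cast (by omega : 0 < N)
  set s := sampleProj S *ᵥ z with hs
  set a := (1 ⬝ᵥ z) / (N : ℝ) with ha
  have hsum : 1 ⬝ᵥ z = N * a := by rw [ha]; field_simp
  have hs2 : z ⬝ᵥ s = ∑ i ∈ S, z i ^ 2 := by
    rw [hs, dotProduct_sampleProj_mulVec]
    exact Finset.sum_congr rfl fun i _ => (sq _).symm
  have hss : s ⬝ᵥ s = ∑ i ∈ S, z i ^ 2 := by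
    nth_rewrite 2 [hs]
    rw [dotProduct_sampleProj_mulVec]
    exact Finset.sum_congr rfl fun i hi => by rw [hs, sampleProj_mulVec, if_pos hi, sq]
  have hs1 : 1 ⬝ᵥ s = 0 := by
    rw [hs, dotProduct_sampleProj_mulVec]; simpa using hz0
  have h11 : (1 : Fin N → ℝ) ⬝ᵥ 1 = N := by simp
  rw [← hs2]
  rw [← hs2] at hss
  have hsz : s ⬝ᵥ z = z ⬝ᵥ s := dotProduct_comm _ _
  have hs1' : s ⬝ᵥ 1 = 0 := by rw [dotProduct_comm, hs1]
  have hz1' : z ⬝ᵥ 1 = N * a := by rw [dotProduct_comm, hsum]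
  -- Lz lives on S and z - s off S, which is the conjugacy required by Wielandt's inequality.
  -- Subtracting the mean a from z and from z - s preserves it and makes z - a orthogonal to
  -- constants.
  have hLs : (G.laplacian *ᵥ z) ⬝ᵥ (z - s) = 0 := by
    refine Finset.sum_eq_zero fun i _ => ?_
    by_cases hi : i ∈ S
    · simp [hs, sampleProj_mulVec, hi]
    · rw [hz i hi, zero_mul]
  have hL1 : (G.laplacian *ᵥ z) ⬝ᵥ 1 = 0 := by rw [dotProduct_comm, one_dotProduct_laplacian]
  have hw := hU.wielandt hN (y := z - a • 1) (v := z - s - a • 1) (b := (l + u) / 2)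
    (d := (u - l) / 2) (by simp [hsum, h11]; ring)
    (by rw [mulVec_sub, mulVec_smul, laplacian_mulVec_one, smul_zero, sub_zero, dotProduct_sub,
          hLs, dotProduct_smul, hL1, smul_zero, sub_zero])
    (by rw [← hl]; ring) (by rw [← hu]; ring)
  set V := (z - s - a • 1) ⬝ᵥ (z - s - a • 1) with hV
  have hV0 : 0 ≤ V := dotProduct_self_nonneg_real _
  have hVe : V = z ⬝ᵥ z - z ⬝ᵥ s - N * a ^ 2 := by
    rw [hV]
    simp only [sub_dotProduct, dotProduct_sub, smul_dotProduct, dotProduct_smul, smul_eq_mul,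
      hss, hsz, hs1, hs1', hsum, hz1', h11]
    ring
  have hyv : (z - a • 1) ⬝ᵥ (z - s - a • 1) = V := by
    rw [hVe]
    simp only [sub_dotProduct, dotProduct_sub, smul_dotProduct, dotProduct_smul, smul_eq_mul,
      hs1, hsum, hz1', h11]
    ring
  have hyy : (z - a • 1) ⬝ᵥ (z - a • 1) = z ⬝ᵥ s + V := by
    rw [hVe]
    simp only [sub_dotProduct, dotProduct_sub, smul_dotProduct, dotProduct_smul, smul_eq_mul,
      hsum, hz1', h11]
    ring
  rw [hyv, hyy] at hw
  have hss0 : 0 ≤ z ⬝ᵥ s := by rw [← hss]; exact dotProduct_self_nonneg_real _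
  have hlu := mul_pos hl0 hu0
  have hVr : V ≤ (r - 1) * (z ⬝ᵥ s) := by
    -- Wielandt reads b²V² ≤ d²(‖s‖² + V)V with b² = λ₂λ_N r and d² = λ₂λ_N(r - 1); cancelling V
    -- needs V > 0.
    rcases hV0.eq_or_lt with h | h
    · rw [← h]; exact mul_nonneg (by linarith) hss0
    · have e1 : ((l + u) / 2) ^ 2 = l * u * r := by linarith
      have e2 : ((u - l) / 2) ^ 2 = l * u * (r - 1) := by linarith
      rw [e1, e2] at hw
      have : l * u * V * (r * V) ≤ l * u * V * ((r - 1) * (z ⬝ᵥ s + V)) := by linarith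
      have := le_of_mul_le_mul_left this (mul_pos hlu h)
      linarith
  -- As z sums to zero on S, its total is carried by the N - |S| vertices off S: Cauchy–Schwarz
  -- against their indicator.
  have hcs : (N * a) ^ 2 ≤ (N - S.card) * (V + N * a ^ 2) := by
    have h1 := sq_dotProduct_le ((1 : Fin N → ℝ) - sampleProj S *ᵥ 1) (z - s)
    have h2 : ((1 : Fin N → ℝ) - sampleProj S *ᵥ 1) ⬝ᵥ (z - s) = N * a := by
      have : (sampleProj S *ᵥ 1) ⬝ᵥ (z - s) = 0 := by
        rw [dotProduct_comm, dotProduct_sampleProj_mulVec]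
        exact Finset.sum_eq_zero fun i hi => by simp [hs, sampleProj_mulVec, hi]
      rw [sub_dotProduct, this, dotProduct_sub, hsum, hs1]
      ring
    have h3 : ((1 : Fin N → ℝ) - sampleProj S *ᵥ 1) ⬝ᵥ (1 - sampleProj S *ᵥ (1 : Fin N → ℝ)) = N - S.card := by
      rw [dotProduct_sub, dotProduct_sampleProj_mulVec, sub_dotProduct, h11,
        dotProduct_comm (sampleProj S *ᵥ 1), dotProduct_sampleProj_mulVec]
      rw [Finset.sum_eq_zero (s := S) (f := fun i => (1 - sampleProj S *ᵥ (1 : Fin N → ℝ)) i * _)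
        (fun i hi => by simp [sampleProj_mulVec, hi])]
      simp
    have h4 : (z - s) ⬝ᵥ (z - s) = V + N * a ^ 2 := by
      rw [hVe]
      simp only [sub_dotProduct, dotProduct_sub, hss, hsz]
      ring
    rwa [h2, h3, h4] at h1
  have hm : (S.card : ℝ) ≤ N := by
    exact_mod_cast S.card_le_univ.trans_eq (Fintype.card_fin N)
  rw [hsum]
  constructor
  · have : (N * a) ^ 2 / (N : ℝ) = N * a ^ 2 := by field_simp
    rw [this]
    linarith
  · have h1 : S.card * (N * a ^ 2) ≤ (N - S.card) * ((r - 1) * (z ⬝ᵥ s)) := by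
      nlinarith [mul_le_mul_of_nonneg_left hVr (sub_nonneg.mpr hm)]
    nlinarith [mul_le_mul_of_nonneg_left h1 hN0.le]

variable {μ : ℝ} (hμ : 0 < μ)
include hμ

theorem glrOperator_le_of_sum_eq_zero (hN : 2 ≤ N) {S : Finset (Fin N)} (hS : S.Nonempty)
    {y : Fin N → ℝ} (hy : ∑ i ∈ S, y i = 0) :
    (G.glrOperator μ S *ᵥ y) ⬝ᵥ (G.glrOperator μ S *ᵥ y) ≤
        spreadR hN lam * ∑ i ∈ S, y i ^ 2 + (1 ⬝ᵥ (G.glrOperator μ S *ᵥ y)) ^ 2 / N ∧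
      S.card * (1 ⬝ᵥ (G.glrOperator μ S *ᵥ y)) ^ 2 ≤
        N * (N - S.card) * (spreadR hN lam - 1) * ∑ i ∈ S, y i ^ 2 := by
  obtain ⟨h1, h2⟩ := hU.harmonic_extension_le hN (S := S) (z := G.glrOperator μ S *ᵥ y)
    (fun i hi => hU.laplacian_glrOperator_eq_zero hμ hS y hi)
    ((hU.sum_glrOperator hμ hS y).trans hy)
  have h3 := hU.sum_sq_glrOperator_le hμ hS y
  have hr := hU.one_le_spreadR hN
  have hm : (S.card : ℝ) ≤ N := by
    exact_mod_cast S.card_le_univ.trans_eq (Fintype.card_fin N)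
  refine ⟨h1.trans (by gcongr), h2.trans (mul_le_mul_of_nonneg_left h3 ?_)⟩
  exact mul_nonneg (mul_nonneg N.cast_nonneg (by linarith)) (by linarith)

omit hU hμ in
theorem _root_.WeightedGraph.glrOperator_col_eq_zero {S : Finset (Fin N)} {j : Fin N} (hj : j ∉ S) :
    (G.glrOperator μ S).col j = 0 := by
  rw [← mulVec_single_one, glrOperator, ← mulVec_mulVec]
  have : sampleProj S *ᵥ Pi.single j (1 : ℝ) = 0 := by
    ext i
    rw [sampleProj_mulVec]
    split_ifs with h
    · exact Pi.single_eq_of_ne (ne_of_mem_of_not_mem h hj) _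
    · rfl
  rw [this, mulVec_zero]

omit hU hμ in
theorem _root_.one_dotProduct_mulVec_eq_sum (A : Matrix (Fin N) (Fin N) ℝ) (w : Fin N → ℝ) :
    1 ⬝ᵥ (A *ᵥ w) = ∑ j, (1 ⬝ᵥ A.col j) * w j := by
  rw [dotProduct_mulVec]
  rfl

/-- The squared Frobenius norm of the GLR operator on `m` samples is at most
`N / m + r (m - 1) + (r - 1) (N / m - 1)`. -/
theorem card_mul_trace_glrOperator_le (hN : 2 ≤ N) {S : Finset (Fin N)} (hS : S.Nonempty) :
    (S.card : ℝ) * (G.glrOperator μ S * (G.glrOperator μ S)ᵀ).trace ≤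
      N + spreadR hN lam * (S.card * (S.card - 1)) + (spreadR hN lam - 1) * (N - S.card) := by
  have hN0 : (0 : ℝ) < N := by exact_mod_cast (by omega : 0 < N)
  have hm0 : (0 : ℝ) < S.card := by exact_mod_cast hS.card_pos
  have hm : (S.card : ℝ) ≤ N := by
    exact_mod_cast S.card_le_univ.trans_eq (Fintype.card_fin N)
  have hr := hU.one_le_spreadR hN
  set r := spreadR hN lam
  set H := G.glrOperator μ S
  set m := (S.card : ℝ) with hmdef
  have hH1 : H *ᵥ 1 = 1 := hU.glrOperator_mulVec_one hμ hS
  have h11 : (1 : Fin N → ℝ) ⬝ᵥ 1 = N := by simp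
  have hcol : ∀ j ∉ S, H.col j = 0 := fun j hj => glrOperator_col_eq_zero hj
  have hcolsum : ∑ j ∈ S, 1 ⬝ᵥ H.col j = N := by
    have h := one_dotProduct_mulVec_eq_sum H 1
    rw [hH1, h11] at h
    rw [h]
    simp only [Pi.one_apply, mul_one]
    exact Finset.sum_subset (Finset.subset_univ S) fun j _ hj => by rw [hcol j hj, dotProduct_zero]
  -- the functional `w ↦ 1 ⬝ H (w - mean of w on S)`
  set g : Fin N → ℝ := fun j => 1 ⬝ᵥ H.col j - (N / m) * (if j ∈ S then 1 else 0) with hg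
  have hgw : ∀ w : Fin N → ℝ, g ⬝ᵥ w = 1 ⬝ᵥ (H *ᵥ (w - ((∑ i ∈ S, w i) / m) • 1)) := by
    intro w
    rw [mulVec_sub, dotProduct_sub, mulVec_smul, hH1, dotProduct_smul, h11,
      one_dotProduct_mulVec_eq_sum]
    simp only [hg, dotProduct, sub_mul, Finset.sum_sub_distrib, mul_assoc, ← Finset.mul_sum,
      ite_mul, one_mul, zero_mul, Finset.sum_ite_mem, Finset.univ_inter, smul_eq_mul]
    ring
  have hcent : ∀ w : Fin N → ℝ, ∑ i ∈ S, (w - ((∑ i ∈ S, w i) / m) • 1) i = 0 ∧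
      ∑ i ∈ S, (w - ((∑ i ∈ S, w i) / m) • 1) i ^ 2 = ∑ i ∈ S, w i ^ 2 - (∑ i ∈ S, w i) ^ 2 / m := by
    intro w
    simp only [Pi.sub_apply, Pi.smul_apply, Pi.one_apply, smul_eq_mul, mul_one, sub_sq,
      Finset.sum_sub_distrib, Finset.sum_add_distrib, Finset.sum_const, nsmul_eq_mul,
      ← Finset.mul_sum, ← Finset.sum_mul, ← hmdef]
    constructor <;> field_simp <;> ring
  -- Bounding the whole functional g at once, rather than each g j separately, keeps the sum over
  -- columns from losing a factor of order m.
  have hgg : m * (g ⬝ᵥ g) ≤ N * (N - m) * (r - 1) := by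
    have hC : 0 ≤ N * (N - m) * (r - 1) / m :=
      div_nonneg (mul_nonneg (mul_nonneg hN0.le (by linarith)) (by linarith)) hm0.le
    have h := dotProduct_self_le_of_sq_dotProduct_le (g := g) hC fun w => by
      rw [hgw, div_mul_eq_mul_div, le_div_iff₀ hm0, mul_comm]
      refine (hU.glrOperator_le_of_sum_eq_zero hμ hN hS (hcent w).1).2.trans ?_
      refine mul_le_mul_of_nonneg_left ?_
        (mul_nonneg (mul_nonneg hN0.le (by linarith)) (by linarith))
      rw [(hcent w).2]
      have h1 : ∑ i ∈ S, w i ^ 2 ≤ w ⬝ᵥ w := by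
        rw [← sqNorm_eq_dotProduct]
        exact Finset.sum_le_sum_of_subset_of_nonneg (Finset.subset_univ S) fun _ _ _ => sq_nonneg _
      have h2 : 0 ≤ (∑ i ∈ S, w i) ^ 2 / m := by positivity
      linarith
    rwa [le_div_iff₀ hm0, mul_comm] at h
  -- The estimate for centred data, applied to the unit vector at j minus 1/m; its image is column j
  -- of H minus the constant 1/m, whose squared norm is expanded.
  have hsingle : ∀ j ∈ S, H.col j ⬝ᵥ H.col j ≤
      r * (1 - 1 / m) + g j ^ 2 / N + (2 / m) * (1 ⬝ᵥ H.col j) - N / m ^ 2 := by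
    intro j hj
    have e1 : ∑ i ∈ S, (Pi.single j (1 : ℝ) : Fin N → ℝ) i = 1 := by
      simp [Pi.single_apply, Finset.sum_ite_eq', hj]
    have e2 : ∑ i ∈ S, (Pi.single j (1 : ℝ) : Fin N → ℝ) i ^ 2 = 1 := by
      simp [Pi.single_apply, Finset.sum_ite_eq', hj]
    have h1 := hcent (Pi.single j 1)
    have h2 := (hU.glrOperator_le_of_sum_eq_zero hμ hN hS h1.1).1
    have hgj : g j = g ⬝ᵥ Pi.single j 1 := by simp
    rw [← hgw, h1.2, ← hgj, e1, e2, one_pow, mulVec_sub, mulVec_smul,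
      show G.glrOperator μ S = H from rfl, hH1, mulVec_single_one] at h2
    simp only [sub_dotProduct, dotProduct_sub, smul_dotProduct, dotProduct_smul, smul_eq_mul, h11,
      dotProduct_comm (H.col j) 1] at h2
    have e3 : (1 / m) * ((1 / m) * (N : ℝ)) = N / m ^ 2 := by field_simp
    have e4 : (2 / m) * (1 ⬝ᵥ H.col j) = 2 * (1 / m * (1 ⬝ᵥ H.col j)) := by ring
    rw [e4]
    linarith
  have hF : (H * Hᵀ).trace = ∑ j ∈ S, H.col j ⬝ᵥ H.col j := by
    rw [trace_mul_transpose_self_eq]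
    exact (Finset.sum_subset (Finset.subset_univ S) fun j _ hj => by
      rw [hcol j hj, dotProduct_zero]).symm
  have hgS : ∑ j ∈ S, g j ^ 2 ≤ g ⬝ᵥ g := by
    rw [← sqNorm_eq_dotProduct]
    exact Finset.sum_le_sum_of_subset_of_nonneg (Finset.subset_univ S) fun _ _ _ => sq_nonneg _
  have hsum := Finset.sum_le_sum hsingle
  simp only [Finset.sum_sub_distrib, Finset.sum_add_distrib, ← Finset.mul_sum, ← Finset.sum_div,
    Finset.sum_const, nsmul_eq_mul, hcolsum, ← hmdef, ← hF] at hsum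
  calc m * (H * Hᵀ).trace ≤ m * (r * (m * 1 - m * 1 / m) + (∑ j ∈ S, g j ^ 2) / N + 2 / m * N
        - m * N / m ^ 2) := mul_le_mul_of_nonneg_left hsum hm0.le
    _ = N + r * (m * (m - 1)) + (m * ∑ j ∈ S, g j ^ 2) / N := by field_simp; ring
    _ ≤ N + r * (m * (m - 1)) + (r - 1) * (N - m) := by
      have : m * ∑ j ∈ S, g j ^ 2 ≤ (r - 1) * (N - m) * N := by
        nlinarith [mul_le_mul_of_nonneg_left hgS hm0.le]
      linarith [(div_le_iff₀ hN0).mpr this]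

theorem trace_glrOperator_le (hN : 2 ≤ N) {S : Finset (Fin N)}
    (hS : S.card = ⌈Real.sqrt N⌉₊) :
    (G.glrOperator μ S * (G.glrOperator μ S)ᵀ).trace ≤ 2 * spreadR hN lam * Real.sqrt N := by
  have hN0 : (0 : ℝ) < N := by exact_mod_cast (by omega : 0 < N)
  have hq : 0 < Real.sqrt N := Real.sqrt_pos.mpr hN0
  have h1 : Real.sqrt N ≤ S.card := by rw [hS]; exact Nat.le_ceil _
  have h2 : (S.card : ℝ) < Real.sqrt N + 1 := by rw [hS]; exact Nat.ceil_lt_add_one hq.le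
  have hm0 : (0 : ℝ) < S.card := hq.trans_le h1
  have hSn : S.Nonempty := Finset.card_pos.mp (by exact_mod_cast hm0)
  have h := hU.card_mul_trace_glrOperator_le hμ hN hSn
  have hr := hU.one_le_spreadR hN
  have h3 : (N : ℝ) ≤ S.card * Real.sqrt N := by
    nlinarith [Real.mul_self_sqrt hN0.le, mul_le_mul_of_nonneg_right h1 hq.le]
  -- The size ⌈√N⌉ balances N/m against m - 1: with N ≤ m√N and m - 1 ≤ √N each contributes at most
  -- r√N after collecting the r terms.
  refine le_of_mul_le_mul_left (h.trans ?_) hm0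
  nlinarith [mul_le_mul_of_nonneg_left h3 (zero_le_one.trans hr),
    mul_nonneg (mul_nonneg (zero_le_one.trans hr) hm0.le) (sub_nonneg.mpr h2.le),
    mul_nonneg hm0.le (sub_nonneg.mpr hr)]

omit hμ in
-- The Frobenius norm may be computed in any orthonormal basis.
theorem sum_glrOperator_col (S : Finset (Fin N)) :
    ∑ j, (G.glrOperator μ S *ᵥ U.col j) ⬝ᵥ (G.glrOperator μ S *ᵥ U.col j) =
      (G.glrOperator μ S * (G.glrOperator μ S)ᵀ).trace := by
  have h := trace_mul_transpose_self_eq (G.glrOperator μ S * U)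
  rw [transpose_mul, ← mul_assoc, mul_assoc _ U, hU.mul_transpose_eq_one, mul_one] at h
  rw [h]
  rfl

/-- The bias of the reconstruction of a bandlimited signal. -/
theorem trace_bias_le {k : ℕ} (hk : k ≤ N) {S : Finset (Fin N)} (hS : S.Nonempty) :
    ((G.glrOperator μ S - 1) * bandlimitProj hk U * (G.glrOperator μ S - 1)ᵀ).trace ≤
      k + (G.glrOperator μ S * (G.glrOperator μ S)ᵀ).trace := by
  rw [bandlimitProj, ← Matrix.mul_assoc, Matrix.mul_assoc, ← transpose_mul, trace_mul_transpose_self_eq,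
    ← hU.sum_glrOperator_col]
  set f : Fin N → ℝ := fun j =>
    (G.glrOperator μ S *ᵥ U.col j) ⬝ᵥ (G.glrOperator μ S *ᵥ U.col j)
  have h1 : ∑ j : Fin k, f (Fin.castLE hk j) ≤ ∑ j, f j := by
    rw [← Fin.coe_castLEEmb hk, ← Finset.sum_map Finset.univ (Fin.castLEEmb hk) f]
    exact Finset.sum_le_sum_of_subset_of_nonneg (Finset.subset_univ _)
      fun _ _ _ => dotProduct_self_nonneg_real _
  calc _ ≤ ∑ j : Fin k, (f (Fin.castLE hk j) + 1) := Finset.sum_le_sum fun j _ =>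
        hU.glrOperator_sub_one_col_le hμ hS (Fin.castLE hk j)
    _ = k + ∑ j : Fin k, f (Fin.castLE hk j) := by
      simp [Finset.sum_add_distrib, add_comm]
    _ ≤ _ := by linarith

omit hμ in
theorem meanEigenvalue_nonneg : 0 ≤ meanEigenvalue lam :=
  mul_nonneg (by positivity) (Finset.sum_nonneg fun i _ => hU.lam_nonneg i)

/-- With every vertex sampled the operator is (1 + μL)⁻¹, with eigenvalues 1/(1 + μλ_j); the bound
is Jensen's inequality for the convex function t⁻². -/
theorem le_trace_glrOperator_univ (hN : 2 ≤ N) :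
    N / (1 + μ * meanEigenvalue lam) ^ 2 ≤
      (G.glrOperator μ Finset.univ * (G.glrOperator μ Finset.univ)ᵀ).trace := by
  have : Nonempty (Fin N) := ⟨⟨0, by omega⟩⟩
  have hN0 : (0 : ℝ) < N := by exact_mod_cast (by omega : 0 < N)
  rw [← hU.sum_glrOperator_col]
  set q := 1 + μ * meanEigenvalue lam with hq
  have hq0 : 0 < q := by have := mul_nonneg hμ.le hU.meanEigenvalue_nonneg; linarith
  have hsum : ∑ j, (1 + μ * lam j) = N * q := by
    rw [hq, meanEigenvalue, Finset.sum_add_distrib, ← Finset.mul_sum]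
    simp
    field_simp
  have hcol : ∀ j, (G.glrOperator μ Finset.univ *ᵥ U.col j) ⬝ᵥ
      (G.glrOperator μ Finset.univ *ᵥ U.col j) = 1 / (1 + μ * lam j) ^ 2 := by
    intro j
    have hdet := hU.isUnit_det_glrMatrix hμ (S := Finset.univ) Finset.univ_nonempty
    have ht : 0 < 1 + μ * lam j := by have := mul_nonneg hμ.le (hU.lam_nonneg j); linarith
    have hD : sampleProj Finset.univ = (1 : Matrix (Fin N) (Fin N) ℝ) := by simp [sampleProj]
    have hA : G.glrMatrix μ Finset.univ *ᵥ U.col j = (1 + μ * lam j) • U.col j := by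
      rw [glrMatrix, hD, add_mulVec, one_mulVec, smul_mulVec, hU.laplacian_mulVec_col, smul_smul,
        add_smul, one_smul]
    have hH : (1 + μ * lam j) • (G.glrOperator μ Finset.univ *ᵥ U.col j) = U.col j := by
      rw [glrOperator, hD, mul_one, ← mulVec_smul, ← hA, mulVec_mulVec, nonsing_inv_mul _ hdet,
        one_mulVec]
    have h := hU.col_dotProduct_self j
    rw [← hH, smul_dotProduct, dotProduct_smul, smul_eq_mul, smul_eq_mul] at h
    rw [eq_div_iff (by positivity)]
    linarith
  -- the tangent line of `t ↦ t⁻²` at `q`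
  have htan : ∀ j, 3 / q ^ 2 - 2 / q ^ 3 * (1 + μ * lam j) ≤ 1 / (1 + μ * lam j) ^ 2 := by
    intro j
    have ht : 0 < 1 + μ * lam j := by have := mul_nonneg hμ.le (hU.lam_nonneg j); linarith
    set t := 1 + μ * lam j
    have e : 1 / t ^ 2 - (3 / q ^ 2 - 2 / q ^ 3 * t) = (t - q) ^ 2 * (2 * t + q) / (t ^ 2 * q ^ 3) := by
      field_simp
      ring
    have : 0 ≤ (t - q) ^ 2 * (2 * t + q) / (t ^ 2 * q ^ 3) := by positivity
    linarith
  simp only [hcol]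
  refine le_trans (le_of_eq ?_) (Finset.sum_le_sum fun j _ => htan j)
  rw [Finset.sum_sub_distrib, ← Finset.mul_sum, hsum]
  simp
  field_simp
  ring

end IsEigendecomposition

end WeightedGraph

/-! ### Second moments of random vectors -/

namespace HasMeanZeroCov

variable {Ω : Type*} [MeasurableSpace Ω] {N : ℕ} {P : Measure Ω} [IsProbabilityMeasure P]
  {g h : Ω → Fin N → ℝ} {C D : Matrix (Fin N) (Fin N) ℝ}

theorem mulVec (hg : HasMeanZeroCov P g C) (A : Matrix (Fin N) (Fin N) ℝ) :
    HasMeanZeroCov P (fun ω => A *ᵥ g ω) (A * C * Aᵀ) := by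
  have hL : ∀ i j, MemLp (fun ω => A i j * g ω j) 2 P := fun i j => (hg.memLp j).const_mul _
  refine ⟨fun i => memLp_finsetSum Finset.univ fun j _ => hL i j, fun i => ?_, fun i j => ?_⟩
  · simp only [Matrix.mulVec, dotProduct]
    rw [integral_finsetSum _ fun j _ => (hL i j).integrable (by norm_num)]
    simp [integral_const_mul, hg.mean_zero]
  · simp only [Matrix.mulVec, dotProduct]
    rw [covariance_fun_sum_fun_sum (hL i) (hL j)]
    simp only [covariance_const_mul_left, covariance_const_mul_right, hg.covariance_eq,
      Matrix.mul_apply, transpose_apply, Finset.sum_mul]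
    rw [Finset.sum_comm]
    exact Finset.sum_congr rfl fun _ _ => Finset.sum_congr rfl fun _ _ => by ring

theorem add_of_indepFun (hg : HasMeanZeroCov P g C) (hh : HasMeanZeroCov P h D)
    (hgh : IndepFun g h P) : HasMeanZeroCov P (fun ω => g ω + h ω) (C + D) := by
  have h0 : ∀ i j, covariance (fun ω => g ω i) (fun ω => h ω j) P = 0 := fun i j =>
    (hgh.comp (measurable_pi_apply i) (measurable_pi_apply j)).covariance_eq_zero
      (hg.memLp i) (hh.memLp j)
  refine ⟨fun i => (hg.memLp i).add (hh.memLp i), fun i => ?_, fun i j => ?_⟩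
  · simp only [Pi.add_apply]
    rw [integral_add ((hg.memLp i).integrable (by norm_num)) ((hh.memLp i).integrable (by norm_num)),
      hg.mean_zero, hh.mean_zero, add_zero]
  · have e : ∀ i, (fun ω => (g ω + h ω) i) = (fun ω => g ω i) + fun ω => h ω i := fun i => rfl
    rw [e, e, covariance_add_left (hg.memLp i) (hh.memLp i) ((hg.memLp j).add (hh.memLp j)),
      covariance_add_right (hg.memLp i) (hg.memLp j) (hh.memLp j),
      covariance_add_right (hh.memLp i) (hg.memLp j) (hh.memLp j), h0,
      covariance_comm (fun ω => h ω i) fun ω => g ω j, h0, hg.covariance_eq, hh.covariance_eq]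
    simp

omit [IsProbabilityMeasure P] in
theorem integrable_sqNorm (hg : HasMeanZeroCov P g C) : Integrable (fun ω => sqNorm (g ω)) P :=
  integrable_finsetSum _ fun i _ => (hg.memLp i).integrable_sq

theorem integral_sqNorm (hg : HasMeanZeroCov P g C) : ∫ ω, sqNorm (g ω) ∂P = C.trace := by
  simp only [sqNorm, trace, diag_apply]
  rw [integral_finsetSum _ fun i _ => (hg.memLp i).integrable_sq]
  refine Finset.sum_congr rfl fun i _ => ?_
  rw [← hg.covariance_eq, covariance_eq_sub (hg.memLp i) (hg.memLp i), hg.mean_zero, mul_zero,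
    sub_zero]
  exact integral_congr_ae (Filter.Eventually.of_forall fun ω => sq _)

theorem lintegral_sqNorm (hg : HasMeanZeroCov P g C) :
    ∫⁻ ω, ENNReal.ofReal (sqNorm (g ω)) ∂P = ENNReal.ofReal C.trace := by
  rw [← hg.integral_sqNorm, ofReal_integral_eq_lintegral_ofReal hg.integrable_sqNorm]
  exact Filter.Eventually.of_forall fun ω => Finset.sum_nonneg fun _ _ => sq_nonneg _

end HasMeanZeroCov

/-! ### Mean squared error, signal-to-noise ratio and the comparison -/

namespace WeightedGraph.IsEigendecomposition

variable {N : ℕ} {G : WeightedGraph N} {U : Matrix (Fin N) (Fin N) ℝ} {lam : Fin N → ℝ}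

theorem trace_bandlimitProj (hU : G.IsEigendecomposition U lam) {k : ℕ} (hk : k ≤ N) :
    (bandlimitProj hk U).trace = k := by
  rw [bandlimitProj, trace_mul_transpose_self_eq]
  calc _ = ∑ _j : Fin k, (1 : ℝ) := Finset.sum_congr rfl fun j _ =>
        hU.col_dotProduct_self (Fin.castLE hk j)
    _ = k := by simp

/-- Bias-variance decomposition of the mean squared error of GLR. -/
theorem glrMSE_eq (hU : G.IsEigendecomposition U lam) {μ : ℝ} (hμ : 0 < μ)
    {Ω : Type*} [MeasurableSpace Ω] {P : Measure Ω} [IsProbabilityMeasure P]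
    {x ε : Ω → Fin N → ℝ} {C : Matrix (Fin N) (Fin N) ℝ} (hx : HasMeanZeroCov P x C)
    (hε : HasMeanZeroCov P ε 1) (hindep : IndepFun x ε P) (σ : ℝ)
    {S : Finset (Fin N)} (hS : S.Nonempty) :
    glrMSE P G μ x (fun ω => σ • ε ω) S = ENNReal.ofReal
      (((G.glrOperator μ S - 1) * C * (G.glrOperator μ S - 1)ᵀ).trace
        + σ ^ 2 * (G.glrOperator μ S * (G.glrOperator μ S)ᵀ).trace) := by
  set H := G.glrOperator μ S
  have hmeas : ∀ A : Matrix (Fin N) (Fin N) ℝ, Measurable fun v : Fin N → ℝ => A *ᵥ v :=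
    fun A => (continuous_const.matrix_mulVec continuous_id).measurable
  -- The error is (H - 1)x + σHε, a sum of independent centred vectors, so the covariances add.
  have h := (hx.mulVec (H - 1)).add_of_indepFun (hε.mulVec (σ • H))
    (hindep.comp (hmeas (H - 1)) (hmeas (σ • H)))
  have herr : ∀ ω, glrReconstruction G μ S (fun i : S => x ω i + (σ • ε ω) i) - x ω =
      (H - 1) *ᵥ x ω + (σ • H) *ᵥ ε ω := by
    intro ω
    rw [show (fun i : S => x ω i + (σ • ε ω) i) = fun i : S => (x ω + σ • ε ω) i from rfl,
      hU.glrReconstruction_eq hμ hS, mulVec_add, mulVec_smul, sub_mulVec, one_mulVec, smul_mulVec]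
    abel
  rw [glrMSE]
  simp only [herr]
  rw [h.lintegral_sqNorm, trace_add]
  congr 2
  rw [mul_one, transpose_smul, smul_mul_smul_comm, trace_smul, smul_eq_mul, ← sq]

end WeightedGraph.IsEigendecomposition

theorem snr_eq {N k : ℕ} {hk : k ≤ N} {G : WeightedGraph N} {U : Matrix (Fin N) (Fin N) ℝ}
    {lam : Fin N → ℝ} (hU : G.IsEigendecomposition U lam)
    {Ω : Type*} [MeasurableSpace Ω] {P : Measure Ω} [IsProbabilityMeasure P]
    {x ε : Ω → Fin N → ℝ} (hx : HasMeanZeroCov P x (bandlimitProj hk U))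
    (hε : HasMeanZeroCov P ε 1) (σ : ℝ) :
    snr P x (fun ω => σ • ε ω) = k / (σ ^ 2 * N) := by
  have h1 : ∫ ω, sqNorm (σ • ε ω) ∂P = σ ^ 2 * N := by
    have e : ∀ ω, sqNorm (σ • ε ω) = σ ^ 2 * sqNorm (ε ω) := fun ω => by
      simp [sqNorm, mul_pow, Finset.mul_sum]
    simp only [e]
    rw [integral_const_mul, hε.integral_sqNorm]
    simp
  rw [snr, hx.integral_sqNorm, hU.trace_bandlimitProj hk, h1]

theorem proposition3 {N k : ℕ} (hN : 2 ≤ N) (hk1 : 1 ≤ k) (hk : k ≤ N)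
    (G : WeightedGraph N) (hconn : G.toSimpleGraph.Connected)
    (U : Matrix (Fin N) (Fin N) ℝ) (lam : Fin N → ℝ) (hU : G.IsEigendecomposition U lam)
    {Ω : Type*} [MeasurableSpace Ω] (P : Measure Ω) [IsProbabilityMeasure P]
    (x ε : Ω → Fin N → ℝ) (σ : ℝ) (hσ : 0 < σ)
    (hx : IsBandlimitedSignal P hk U x)
    (hε : HasMeanZeroCov P ε 1)
    (hindep : IndepFun x ε P)
    (hr : 2 * spreadR hN lam * Real.sqrt N < N)
    (μ : ℝ) (hμ : μ ∈ Set.Ioo 0 (muUbWeak hN lam))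
    (hsnr : snr P x (fun ω => σ • ε ω) < tauGLRWeak hN k lam μ)
    (S : Finset (Fin N)) (hS : S.card = ⌈Real.sqrt N⌉₊) :
    GLRBetterThan P G μ x (fun ω => σ • ε ω) S Finset.univ := by
  have hμ0 : 0 < μ := hμ.1
  have : Nonempty (Fin N) := ⟨⟨0, by omega⟩⟩
  have hN0 : (0 : ℝ) < N := by exact_mod_cast (by omega : 0 < N)
  have hk0 : (0 : ℝ) < k := by exact_mod_cast hk1
  have hq : 0 < Real.sqrt N := Real.sqrt_pos.mpr hN0
  have hSn : S.Nonempty := by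
    rw [← Finset.card_pos, hS]
    exact Nat.ceil_pos.mpr hq
  have hbias := hU.trace_bias_le hμ0 hk hSn
  have hvar := hU.trace_glrOperator_le hμ0 hN hS
  have hlow := hU.le_trace_glrOperator_univ hμ0 hN
  have hr1 := hU.one_le_spreadR hN
  rw [snr_eq hU hx.moments hε, tauGLRWeak] at hsnr
  rw [GLRBetterThan, hU.glrMSE_eq hμ0 hx.moments hε hindep σ hSn,
    hU.glrMSE_eq hμ0 hx.moments hε hindep σ Finset.univ_nonempty]
  have hlow0 : 0 ≤ ((G.glrOperator μ Finset.univ - 1) * bandlimitProj hk U *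
      (G.glrOperator μ Finset.univ - 1)ᵀ).trace := by
    rw [bandlimitProj, ← Matrix.mul_assoc, Matrix.mul_assoc, ← transpose_mul,
      trace_mul_transpose_self_eq]
    exact Finset.sum_nonneg fun _ _ => dotProduct_self_nonneg_real _
  set r := spreadR hN lam
  set s := Real.sqrt N
  set t := 1 + μ * meanEigenvalue lam
  have hs2 : s * s = N := Real.mul_self_sqrt hN0.le
  have hσ2 : 0 < σ ^ 2 := by positivity
  -- This is SNR = k/(σ²N) < τ with denominators cleared and one factor √N cancelled. The left side
  -- bounds the bias k + 2r√N plus the variance 2r√N σ² on S.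
  have hkey : k + 2 * r * s * (1 + σ ^ 2) < σ ^ 2 * (N / t ^ 2) := by
    have hden : 0 < s + 2 * r * (N / k) := by positivity
    rw [div_lt_div_iff₀ (by positivity) hden] at hsnr
    have e1 : k * (s + 2 * r * (N / k)) = s * (k + 2 * r * s) := by
      rw [← hs2]; field_simp
    have e2 : (s / t ^ 2 - 2 * r) * (σ ^ 2 * N) = s * (σ ^ 2 * (N / t ^ 2) - 2 * r * s * σ ^ 2) := by
      nth_rewrite 1 [← hs2]
      rw [← hs2]; ring
    rw [e1, e2] at hsnr
    have := lt_of_mul_lt_mul_left hsnr hq.le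
    linarith
  have h1 := mul_le_mul_of_nonneg_left hvar hσ2.le
  have h2 := mul_le_mul_of_nonneg_left hlow hσ2.le
  -- `ENNReal.ofReal` truncates at 0, so strictness survives only if the larger error is positive.
  have h3 : 0 < σ ^ 2 * ((N : ℝ) / t ^ 2) := lt_trans (by positivity) hkey
  exact (ENNReal.ofReal_lt_ofReal_iff (by linarith)).mpr (by linarith)
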